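/- Let $n\ge 1$, let $\mathbb H=\{\lambda\in\mathbb C:\operatorname{Im}\lambda>0\}$, and let $\mathcal C$ be the family of holomorphic maps $f:\mathbb H^n\to\mathbb H$ such that, for all $\lambda\in\mathbb H$ and $j=1,\dots,n$, $$f(\lambda,\dots,\lambda)=\lambda,\qquad \frac{\partial f}{\partial z_j}(\lambda,\dots,\lambda)=\frac1n .$$ Equip $\mathcal C$ with the compact-open topology and its Borel $\sigma$-algebra. The translation flow on $\mathcal C$ is the continuous action of $\mathbb R$ on $\mathcal C$ given by $$f_t(z_1,\dots,z_n)=f(z_1-t,\dots,z_n-t)+t\qquad(t\in\mathbb R).$$ Let $\mathbf g\in\mathcal C$ be the map $\mathbf g(z)=\frac1n\sum_{j=1}^n z_j$. Then a Borel probability measure $\mu$ on $\mathcal C$ is invariant under the translation flow (that is, its push-forward under $f\mapsto f_t$ equals $\mu$ for every $t\in\mathbb R$) if and only if $\mu$ is the Dirac measure $\delta_{\mathbf g}$. In particular, the translation flow on $\mathcal C$ is uniquely ergodic: it has exactly one invariant Borel probability measure. -/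

import Mathlib

open UpperHalfPlane MeasureTheory

noncomputable section

namespace PolyPlane

/-- The poly-plane `ℍⁿ` as an open subset of `ℂⁿ`. -/
def polyPlane (n : ℕ) : Set (Fin n → ℂ) := {z | ∀ j, 0 < (z j).im}

/-- A map `f : ℍⁿ → ℍ` read in the coordinates of `ℂⁿ` and `ℂ`. Its values outside the open set
`polyPlane n` are junk, and are never used below. -/
def coords {n : ℕ} (f : (Fin n → ℍ) → ℍ) (z : Fin n → ℂ) : ℂ :=
  (f (fun j => ofComplex (z j)) : ℂ)

/-- The partial derivative `∂F/∂z_j` at the point `z`. -/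
def partialDeriv {n : ℕ} (F : (Fin n → ℂ) → ℂ) (j : Fin n) (z : Fin n → ℂ) : ℂ :=
  deriv (fun w : ℂ => F (Function.update z j w)) (z j)

/-- Membership in the family `𝒞`: holomorphic maps `ℍⁿ → ℍ` that restrict to the identity on the
diagonal and all of whose first partial derivatives equal `1/n` along the diagonal. -/
structure IsC {n : ℕ} (f : (Fin n → ℍ) → ℍ) : Prop where
  holo : DifferentiableOn ℂ (coords f) (polyPlane n)
  diag : ∀ l : ℍ, f (fun _ => l) = l
  deriv_diag : ∀ (l : ℍ) (j : Fin n), partialDeriv (coords f) j (fun _ => (l : ℂ)) = 1 / (n : ℂ)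

/-- The space `𝒞`. -/
def FamC (n : ℕ) : Type := {f : C(Fin n → ℍ, ℍ) // IsC f}

/-- `𝒞` carries the compact-open topology. -/
instance (n : ℕ) : TopologicalSpace (FamC n) :=
  inferInstanceAs (TopologicalSpace {f : C(Fin n → ℍ, ℍ) // IsC f})

/-- `𝒞` carries the Borel σ-algebra of the compact-open topology. -/
instance (n : ℕ) : MeasurableSpace (FamC n) := borel (FamC n)

instance (n : ℕ) : BorelSpace (FamC n) := ⟨rfl⟩

theorem coords_of_mem {n : ℕ} (f : (Fin n → ℍ) → ℍ) {z : Fin n → ℂ} (hz : z ∈ polyPlane n) :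
    coords f z = (f (fun j => ⟨z j, hz j⟩) : ℂ) := by
  unfold coords
  congr 2
  funext j
  exact ofComplex_apply_of_im_pos (hz j)

theorem isOpen_polyPlane (n : ℕ) : IsOpen (polyPlane n) := by
  have h : polyPlane n = ⋂ j, {z : Fin n → ℂ | 0 < (z j).im} := by
    ext z; simp [polyPlane]
  rw [h]
  exact isOpen_iInter_of_finite fun j =>
    isOpen_lt continuous_const (Complex.continuous_im.comp (continuous_apply j))

theorem diag_mem {n : ℕ} (l : ℍ) : (fun _ => (l : ℂ)) ∈ polyPlane n := fun _ => l.im_pos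

theorem update_diag_mem {n : ℕ} (l : ℍ) (j : Fin n) :
    ∀ᶠ w in nhds (l : ℂ), Function.update (fun _ => (l : ℂ)) j w ∈ polyPlane n := by
  have hc : Continuous fun w : ℂ => Function.update (fun _ : Fin n => (l : ℂ)) j w :=
    continuous_const.update j continuous_id
  refine hc.continuousAt.eventually_mem ((isOpen_polyPlane n).mem_nhds ?_)
  simpa using diag_mem l

/-- The translate `f_t (z₁, …, zₙ) = f (z₁ - t, …, zₙ - t) + t`. -/
def translate {n : ℕ} (t : ℝ) (f : C(Fin n → ℍ, ℍ)) : C(Fin n → ℍ, ℍ) where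
  toFun z := t +ᵥ f (fun j => (-t) +ᵥ z j)
  continuous_toFun := by
    refine (isometry_real_vadd t).continuous.comp (f.continuous.comp ?_)
    exact continuous_pi fun j => (isometry_real_vadd (-t)).continuous.comp (continuous_apply j)

theorem coords_translate {n : ℕ} (t : ℝ) (f : C(Fin n → ℍ, ℍ)) {z : Fin n → ℂ}
    (hz : z ∈ polyPlane n) :
    coords (translate t f) z = coords f (fun j => z j - t) + t := by
  have hz' : (fun j => z j - (t : ℂ)) ∈ polyPlane n := fun j => by simpa using hz j
  rw [coords_of_mem _ hz, coords_of_mem _ hz']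
  change ((t +ᵥ f (fun j => (-t) +ᵥ (⟨z j, hz j⟩ : ℍ)) : ℍ) : ℂ) = _
  rw [coe_vadd, add_comm]
  congr 3
  funext j
  apply UpperHalfPlane.ext
  rw [coe_vadd]
  push_cast
  ring

theorem IsC.translate {n : ℕ} (t : ℝ) {f : C(Fin n → ℍ, ℍ)} (hf : IsC f) :
    IsC (translate t f) where
  holo := by
    have h : DifferentiableOn ℂ (fun z : Fin n → ℂ => coords f (fun j => z j - t) + t)
        (polyPlane n) := by
      refine DifferentiableOn.add_const _ (hf.holo.comp ?_ ?_)
      · fun_prop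
      · intro z hz j
        simpa using hz j
    exact h.congr fun z hz => coords_translate t f hz
  diag l := by
    change t +ᵥ f (fun _ => (-t) +ᵥ l) = l
    rw [hf.diag, vadd_vadd]
    simp
  deriv_diag l j := by
    have h1 : (fun w : ℂ => coords (PolyPlane.translate t f)
          (Function.update (fun _ => (l : ℂ)) j w)) =ᶠ[nhds (l : ℂ)]
        fun w => coords f (Function.update (fun _ => (((-t) +ᵥ l : ℍ) : ℂ)) j (w - t)) + t := by
      filter_upwards [update_diag_mem l j] with w hw
      rw [coords_translate t f hw]
      congr 2
      funext k
      by_cases hk : k = j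
      · subst hk; simp
      · simp [hk, coe_vadd]; ring
    have h2 := hf.deriv_diag ((-t) +ᵥ l) j
    have h3 : (l : ℂ) - t = (((-t) +ᵥ l : ℍ) : ℂ) := by
      rw [coe_vadd]; push_cast; ring
    unfold partialDeriv at h2 ⊢
    rw [h1.deriv_eq, deriv_add_const,
      deriv_comp_sub_const (f := fun w => coords f
        (Function.update (fun _ => (((-t) +ᵥ l : ℍ) : ℂ)) j w)), h3]
    exact h2

/-- The translation flow `(f, t) ↦ f_t` on `𝒞`, as a continuous action of `ℝ`. -/
def translationFlow (n : ℕ) : Flow ℝ (FamC n) where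
  toFun t f := ⟨translate t f.1, f.2.translate t⟩
  cont' := by
    refine Continuous.subtype_mk ?_ _
    apply ContinuousMap.continuous_of_continuous_uncurry
    have hv : Continuous fun p : ℝ × ℍ => p.1 +ᵥ p.2 := by
      refine isEmbedding_coe.continuous_iff.2 ?_
      have : (UpperHalfPlane.coe ∘ fun p : ℝ × ℍ => p.1 +ᵥ p.2)
          = fun p => (p.1 : ℂ) + (p.2 : ℂ) := by
        funext p; exact coe_vadd _ _
      rw [this]
      exact (Complex.continuous_ofReal.comp continuous_fst).add
        (continuous_coe.comp continuous_snd)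
    have hf : Continuous fun p : (ℝ × FamC n) × (Fin n → ℍ) => p.1.2.1 :=
      continuous_subtype_val.comp (continuous_snd.comp continuous_fst)
    have ht : Continuous fun p : (ℝ × FamC n) × (Fin n → ℍ) => p.1.1 :=
      continuous_fst.comp continuous_fst
    have hz : Continuous fun p : (ℝ × FamC n) × (Fin n → ℍ) =>
        (fun j => (-p.1.1) +ᵥ p.2 j : Fin n → ℍ) :=
      continuous_pi fun j =>
        hv.comp (ht.neg.prodMk ((continuous_apply j).comp continuous_snd))
    exact hv.comp (ht.prodMk (hf.eval hz))
  map_add' s t f := by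
    apply Subtype.ext
    ext z
    change (((s + t) +ᵥ f.1 (fun j => (-(s + t)) +ᵥ z j) : ℍ) : ℂ)
      = ((s +ᵥ (t +ᵥ f.1 (fun j => (-t) +ᵥ ((-s) +ᵥ z j))) : ℍ) : ℂ)
    simp only [vadd_vadd, neg_add_rev]
  map_zero' f := by
    apply Subtype.ext
    ext z
    change ((((0 : ℝ) +ᵥ f.1 (fun j => (-(0 : ℝ)) +ᵥ z j)) : ℍ) : ℂ) = _
    simp

/-- The average `g (z) = (1/n) ∑ z_j` of `n ≥ 1` points of `ℍ`, as a point of `ℍ`. -/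
def meanPoint {n : ℕ} [NeZero n] (z : Fin n → ℍ) : ℍ :=
  ⟨(1 / (n : ℂ)) * ∑ j, (z j : ℂ), by
    have hn : (0 : ℝ) < n := by exact_mod_cast NeZero.pos n
    have h : (1 / (n : ℂ)) = (((1 / n : ℝ)) : ℂ) := by push_cast; rfl
    rw [h, Complex.im_ofReal_mul, Complex.im_sum]
    exact mul_pos (by positivity)
      (Finset.sum_pos (fun j _ => (z j).im_pos) Finset.univ_nonempty)⟩

theorem coords_meanPoint {n : ℕ} [NeZero n] {z : Fin n → ℂ} (hz : z ∈ polyPlane n) :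
    coords meanPoint z = (1 / (n : ℂ)) * ∑ j, z j :=
  coords_of_mem _ hz

theorem isC_meanPoint {n : ℕ} [NeZero n] : IsC (meanPoint (n := n)) where
  holo := by
    have h : DifferentiableOn ℂ (fun z : Fin n → ℂ => (1 / (n : ℂ)) * ∑ j, z j)
        (polyPlane n) := by fun_prop
    exact h.congr fun z hz => coords_meanPoint hz
  diag l := by
    apply UpperHalfPlane.ext
    change (1 / (n : ℂ)) * ∑ _j : Fin n, (l : ℂ) = l
    have hn : (n : ℂ) ≠ 0 := by exact_mod_cast NeZero.ne n
    simp [hn]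
  deriv_diag l j := by
    have h1 : (fun w : ℂ => coords meanPoint (Function.update (fun _ => (l : ℂ)) j w))
        =ᶠ[nhds (l : ℂ)]
        fun w => (1 / (n : ℂ)) * (w + ∑ _k ∈ Finset.univ \ {j}, (l : ℂ)) := by
      filter_upwards [update_diag_mem l j] with w hw
      rw [coords_meanPoint hw, Finset.sum_update_of_mem (Finset.mem_univ j)]
    unfold partialDeriv
    rw [h1.deriv_eq, deriv_const_mul_field, deriv_add_const]
    simp

/-- The function `g (z) = (1/n) ∑ z_j` as an element of `𝒞`. -/
def meanC (n : ℕ) [NeZero n] : FamC n :=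
  ⟨⟨meanPoint, by
    refine isEmbedding_coe.continuous_iff.2 ?_
    change Continuous fun z : Fin n → ℍ => (1 / (n : ℂ)) * ∑ j, (z j : ℂ)
    exact continuous_const.mul (continuous_finsetSum _ fun j _ =>
      continuous_coe.comp (continuous_apply j))⟩, isC_meanPoint⟩

/-- The measure `μ` is invariant under the flow `φ`: `(φ_t)_* μ = μ` for every time `t`. -/
def IsInvariantMeasure {X : Type*} [TopologicalSpace X] [MeasurableSpace X]
    (φ : Flow ℝ X) (μ : Measure X) : Prop :=
  ∀ t : ℝ, MeasurePreserving (φ t) μ μ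

/-- A flow is uniquely ergodic if it has exactly one invariant Borel probability measure. -/
def IsUniquelyErgodic {X : Type*} [TopologicalSpace X] [MeasurableSpace X] [BorelSpace X]
    (φ : Flow ℝ X) : Prop :=
  ∃! μ : Measure X, IsProbabilityMeasure μ ∧ IsInvariantMeasure φ μ

end PolyPlane

end

noncomputable section

namespace PolyPlane

open Filter Topology

/-! For real `x`, restrict `f` to the line through `x` parallel to the diagonal and set h_f(s) = f(x
+ s) - s on the upper half-plane (`diagSub`). Two facts hold for every `f` in the family.

Positivity (`IsC.im_le`): Im h_f ≥ 0. Since `f` fixes the diagonal, the Schwarz lemma applies at the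
diagonal point over iY; letting Y → ∞ turns it into a Julia-type inequality at infinity.

Asymptotics (`IsC.norm_sub_mean_le`): h_f(iY) tends to the mean of `x`, uniformly in `f`. The
derivative condition makes `f` minus the mean vanish to second order at the diagonal point over iY,
and a higher-order Schwarz lemma gives an error O(1/Y).

The flow moves the argument of h_f by a real number. Hence for an invariant probability measure the
average of h_f is holomorphic and invariant under real translations, so constant, so equal to its
limit, the mean of `x`, which is real (`integral_diagSub_eq`). Thus the nonnegative function Im h_f
has integral zero and vanishes almost surely. By the open mapping theorem h_f is then constant,
equal to the mean of `x`; countably many `x` and the identity theorem give `f = meanC n` almost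
surely. -/

theorem coords_im_pos {n : ℕ} (f : (Fin n → ℍ) → ℍ) (z : Fin n → ℂ) : 0 < (coords f z).im :=
  (f _).im_pos

theorem IsC.coords_diag {n : ℕ} {f : (Fin n → ℍ) → ℍ} (hf : IsC f) {l : ℂ} (hl : 0 < l.im) :
    coords f (fun _ => l) = l := by
  have h := coords_of_mem f (z := fun _ : Fin n => l) (fun _ => hl)
  rw [h, hf.diag ⟨l, hl⟩]

/-! ### Cayley transforms and the Schwarz lemma on the diagonal -/

theorem add_ofReal_mul_I_ne_zero {z : ℂ} {Y : ℝ} (hz : 0 < z.im) (hY : 0 < Y) :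
    z + Y * Complex.I ≠ 0 := by
  intro h
  have := congrArg Complex.im h
  simp at this
  linarith

/-- The Cayley transform of the upper half-plane that is centred at `Y * I`. -/
def cayley (Y : ℝ) (z : ℂ) : ℂ := (z - Y * Complex.I) / (z + Y * Complex.I)

/-- The inverse of the Cayley transform `cayley Y`. -/
def cayleyInv (Y : ℝ) (a : ℂ) : ℂ := Y * Complex.I * (1 + a) / (1 - a)

/-- Converts a comparison of Cayley moduli into one of Im z / |z + iY|², a form in which Y can be
sent to infinity. -/
theorem norm_cayley_sq {z : ℂ} {Y : ℝ} (hz : 0 < z.im) (hY : 0 < Y) :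
    ‖cayley Y z‖ ^ 2 = 1 - 4 * Y * (z.im / ‖z + Y * Complex.I‖ ^ 2) := by
  have h0 : ‖z + Y * Complex.I‖ ≠ 0 := norm_ne_zero_iff.2 (add_ofReal_mul_I_ne_zero hz hY)
  have h1 : ‖z - Y * Complex.I‖ ^ 2 = ‖z + Y * Complex.I‖ ^ 2 - 4 * Y * z.im := by
    rw [← Complex.normSq_eq_norm_sq, ← Complex.normSq_eq_norm_sq, Complex.normSq_apply,
      Complex.normSq_apply]
    simp
    ring
  rw [cayley, norm_div, div_pow, h1]
  field_simp

theorem norm_cayley_lt_one {z : ℂ} {Y : ℝ} (hz : 0 < z.im) (hY : 0 < Y) : ‖cayley Y z‖ < 1 := by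
  have h0 : 0 < ‖z + Y * Complex.I‖ := norm_pos_iff.2 (add_ofReal_mul_I_ne_zero hz hY)
  have h := norm_cayley_sq hz hY
  have : 0 < 4 * Y * (z.im / ‖z + Y * Complex.I‖ ^ 2) := by positivity
  nlinarith [norm_nonneg (cayley Y z)]

theorem cayleyInv_cayley {z : ℂ} {Y : ℝ} (hz : 0 < z.im) (hY : 0 < Y) :
    cayleyInv Y (cayley Y z) = z := by
  have h0 := add_ofReal_mul_I_ne_zero hz hY
  have hY' : (Y : ℂ) ≠ 0 := by exact_mod_cast hY.ne'
  have h1 : 1 - (z - Y * Complex.I) / (z + Y * Complex.I)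
      = 2 * Y * Complex.I / (z + Y * Complex.I) := by
    field_simp; ring
  have h2 : 1 + (z - Y * Complex.I) / (z + Y * Complex.I) = 2 * z / (z + Y * Complex.I) := by
    field_simp; ring
  rw [cayleyInv, cayley, h1, h2]
  field_simp

theorem cayleyInv_im_pos {a : ℂ} {Y : ℝ} (ha : ‖a‖ < 1) (hY : 0 < Y) : 0 < (cayleyInv Y a).im := by
  have h1 : (1 - a) ≠ 0 := by
    intro h
    rw [← sub_eq_zero.1 h] at ha
    simp at ha
  have hn : 0 < Complex.normSq (1 - a) := Complex.normSq_pos.2 h1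
  have h2 : (cayleyInv Y a).im = Y * (1 - ‖a‖ ^ 2) / Complex.normSq (1 - a) := by
    rw [← Complex.normSq_eq_norm_sq, cayleyInv, Complex.div_im, Complex.normSq_apply a]
    simp
    ring
  rw [h2]
  have : ‖a‖ ^ 2 < 1 := by nlinarith [norm_nonneg a]
  exact div_pos (mul_pos hY (by linarith)) hn

theorem differentiableOn_cayley {Y : ℝ} (hY : 0 < Y) :
    DifferentiableOn ℂ (cayley Y) {z | 0 < z.im} :=
  DifferentiableOn.div (c := fun z => z - Y * Complex.I) (d := fun z => z + Y * Complex.I)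
    (by fun_prop) (by fun_prop) fun _ hz => add_ofReal_mul_I_ne_zero hz hY

theorem differentiableOn_cayleyInv (Y : ℝ) :
    DifferentiableOn ℂ (cayleyInv Y) (Metric.ball 0 1) := by
  refine DifferentiableOn.div (c := fun a => Y * Complex.I * (1 + a)) (d := fun a => 1 - a)
    (by fun_prop) (by fun_prop) fun a ha h => ?_
  rw [← sub_eq_zero.1 h] at ha
  simp at ha

/-- The Schwarz lemma for maps of the family `𝒞`, based at the diagonal point over `Y * I`. -/
theorem IsC.schwarz {n : ℕ} [NeZero n] {f : (Fin n → ℍ) → ℍ} (hf : IsC f) {z : Fin n → ℂ}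
    (hz : z ∈ polyPlane n) {Y : ℝ} (hY : 0 < Y) :
    ∃ j, (z j).im / ‖z j + Y * Complex.I‖ ^ 2
      ≤ (coords f z).im / ‖coords f z + Y * Complex.I‖ ^ 2 := by
  -- The polydisc is the unit ball of the sup norm, so Schwarz bounds the Cayley modulus of the
  -- value by the largest coordinate modulus, attained at this `j`.
  obtain ⟨j, hj⟩ := Finite.exists_max fun j => ‖cayley Y (z j)‖
  refine ⟨j, ?_⟩
  let G : (Fin n → ℂ) → ℂ := fun a => cayley Y (coords f fun k => cayleyInv Y (a k))
  have hmem : ∀ a ∈ Metric.ball (0 : Fin n → ℂ) 1, ∀ k, ‖a k‖ < 1 := fun a ha k =>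
    (norm_le_pi_norm a k).trans_lt (mem_ball_zero_iff.1 ha)
  have hG : DifferentiableOn ℂ G (Metric.ball 0 1) := by
    have hinv : DifferentiableOn ℂ (fun (a : Fin n → ℂ) k => cayleyInv Y (a k))
        (Metric.ball 0 1) :=
      differentiableOn_pi.2 fun k => (differentiableOn_cayleyInv Y).comp
        (differentiable_apply k).differentiableOn
        fun a ha => mem_ball_zero_iff.2 (hmem a ha k)
    exact (differentiableOn_cayley hY).comp
      (hf.holo.comp hinv fun a ha k => cayleyInv_im_pos (hmem a ha k) hY)
      fun a _ => coords_im_pos f _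
  have hG0 : G 0 = 0 := by
    have : coords f (fun k : Fin n => cayleyInv Y ((0 : Fin n → ℂ) k)) = Y * Complex.I := by
      simp only [cayleyInv, Pi.zero_apply, add_zero, sub_zero, mul_one, div_one]
      exact hf.coords_diag (by simpa using hY)
    simp only [G, this, cayley, sub_self, zero_div]
  have hmaps : Set.MapsTo G (Metric.ball 0 1) (Metric.closedBall 0 1) := fun a _ =>
    mem_closedBall_zero_iff.2 (norm_cayley_lt_one (coords_im_pos f _) hY).le
  have hle : ‖fun k => cayley Y (z k)‖ ≤ ‖cayley Y (z j)‖ :=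
    (pi_norm_le_iff_of_nonneg (norm_nonneg _)).2 hj
  have h := Complex.norm_le_norm_of_mapsTo_ball hG hmaps hG0
    (hle.trans_lt (norm_cayley_lt_one (hz j) hY))
  have hGz : G (fun k => cayley Y (z k)) = cayley Y (coords f z) := by
    simp only [G, cayleyInv_cayley (hz _) hY]
  rw [hGz] at h
  have h' := pow_le_pow_left₀ (norm_nonneg _) (h.trans hle) 2
  rw [norm_cayley_sq (hz j) hY, norm_cayley_sq (coords_im_pos f z) hY] at h'
  nlinarith

/-- Im w ≤ |w + iY| bounds the right side of `IsC.schwarz` by 1 / |w + iY|, so the inequality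
becomes an upper bound on |w + iY| that does not depend on `f`. -/
theorem IsC.norm_coords_add_le {n : ℕ} [NeZero n] {f : (Fin n → ℍ) → ℍ} (hf : IsC f)
    {z : Fin n → ℂ} {Y m R : ℝ} (hY : 0 < Y) (hm : 0 < m) (hz : ∀ j, m ≤ (z j).im)
    (hR : ∀ j, ‖z j + Y * Complex.I‖ ≤ R) :
    ‖coords f z + Y * Complex.I‖ ≤ R ^ 2 / m := by
  have hz' : z ∈ polyPlane n := fun j => hm.trans_le (hz j)
  obtain ⟨j, hj⟩ := hf.schwarz hz' hY
  have h0 : 0 < ‖z j + Y * Complex.I‖ := norm_pos_iff.2 (add_ofReal_mul_I_ne_zero (hz' j) hY)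
  have h1 : 0 < ‖coords f z + Y * Complex.I‖ :=
    norm_pos_iff.2 (add_ofReal_mul_I_ne_zero (coords_im_pos f z) hY)
  have h2 : (coords f z).im ≤ ‖coords f z + Y * Complex.I‖ := by
    refine le_trans ?_ (Complex.im_le_norm _)
    simp [hY.le]
  have h3 : m / R ^ 2 ≤ (z j).im / ‖z j + Y * Complex.I‖ ^ 2 := by
    have := hz j
    have := hR j
    gcongr
    exact (hz' j).le
  have hR0 : 0 < R := h0.trans_le (hR j)
  have h4 := h3.trans hj
  rw [div_le_div_iff₀ (by positivity) (by positivity)] at h4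
  rw [le_div_iff₀ hm]
  have h5 : ‖coords f z + Y * Complex.I‖ * (‖coords f z + Y * Complex.I‖ * m)
      ≤ ‖coords f z + Y * Complex.I‖ * R ^ 2 := by nlinarith
  exact le_of_mul_le_mul_left h5 h1

/-- On a real translate of the diagonal, a map of the family `𝒞` does not decrease the imaginary
part. -/
theorem IsC.im_le {n : ℕ} [NeZero n] {f : (Fin n → ℍ) → ℍ} (hf : IsC f) (x : Fin n → ℝ) {s : ℂ}
    (hs : 0 < s.im) : s.im ≤ (coords f fun j => x j + s).im := by
  set w := coords f fun j => x j + s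
  set C := ‖x‖ + ‖s‖
  have hC : 0 ≤ C := by positivity
  -- The index given by Schwarz may vary with Y, but `C` bounds |x_j + s| for every j.
  have key : ∀ Y : ℝ, 0 < Y → s.im ≤ w.im * (1 + C / Y) ^ 2 := by
    intro Y hY
    obtain ⟨j, hj⟩ := hf.schwarz (z := fun j => x j + s) (fun j => by simpa using hs) hY
    have h1 : ‖(x j + s : ℂ) + Y * Complex.I‖ ≤ C + Y := by
      refine (norm_add_le _ _).trans (add_le_add ((norm_add_le _ _).trans ?_) ?_)
      · simpa [C] using norm_le_pi_norm x j
      · simp [abs_of_pos hY]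
    have h2 : Y ≤ ‖w + Y * Complex.I‖ := by
      refine le_trans ?_ (Complex.im_le_norm _)
      simpa using (coords_im_pos f _).le
    have h0 : 0 < ‖(x j + s : ℂ) + Y * Complex.I‖ :=
      norm_pos_iff.2 (add_ofReal_mul_I_ne_zero (by simpa using hs) hY)
    have hw : 0 < w.im := coords_im_pos f _
    have h3 : s.im / (C + Y) ^ 2 ≤ w.im / Y ^ 2 := by
      calc s.im / (C + Y) ^ 2 ≤ s.im / ‖(x j + s : ℂ) + Y * Complex.I‖ ^ 2 := by gcongr
        _ ≤ w.im / ‖w + Y * Complex.I‖ ^ 2 := by simpa using hj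
        _ ≤ w.im / Y ^ 2 := by gcongr
    rw [div_le_div_iff₀ (by positivity) (by positivity)] at h3
    have h4 : w.im * (1 + C / Y) ^ 2 = w.im * (C + Y) ^ 2 / Y ^ 2 := by
      field_simp; ring
    rw [h4, le_div_iff₀ (by positivity)]
    exact h3
  have hlim : Tendsto (fun Y : ℝ => w.im * (1 + C / Y) ^ 2) atTop (𝓝 (w.im * (1 + 0) ^ 2)) :=
    ((tendsto_const_nhds.add (tendsto_const_nhds.div_atTop tendsto_id)).pow 2).const_mul _
  have h := ge_of_tendsto hlim (eventually_atTop.2 ⟨1, fun Y hY => key Y (by linarith)⟩)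
  simpa using h

/-! ### Second-order contact with the mean near infinity -/

/-- The arithmetic mean as a continuous linear functional on `ℂⁿ`. -/
def meanCLM (n : ℕ) : (Fin n → ℂ) →L[ℂ] ℂ :=
  (1 / (n : ℂ)) • ∑ j, ContinuousLinearMap.proj (R := ℂ) (φ := fun _ : Fin n => ℂ) j

theorem meanCLM_apply {n : ℕ} (z : Fin n → ℂ) : meanCLM n z = (1 / (n : ℂ)) * ∑ j, z j := by
  simp [meanCLM]

theorem meanCLM_const {n : ℕ} [NeZero n] (l : ℂ) : meanCLM n (fun _ => l) = l := by
  have hn : (n : ℂ) ≠ 0 := by exact_mod_cast NeZero.ne n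
  rw [meanCLM_apply]
  simp [hn]

theorem norm_meanCLM_le {n : ℕ} [NeZero n] (z : Fin n → ℂ) : ‖meanCLM n z‖ ≤ ‖z‖ := by
  have hn : (0 : ℝ) < n := by exact_mod_cast NeZero.pos n
  have h : ‖∑ j, z j‖ ≤ n * ‖z‖ := by
    refine (norm_sum_le _ _).trans ((Finset.sum_le_card_nsmul _ _ ‖z‖ fun j _ =>
      norm_le_pi_norm z j).trans ?_)
    simp
  rw [meanCLM_apply, norm_mul, norm_div, norm_one, Complex.norm_natCast, one_div,
    inv_mul_le_iff₀ hn]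
  exact h

theorem IsC.hasFDerivAt {n : ℕ} {f : (Fin n → ℍ) → ℍ} (hf : IsC f) {l : ℂ} (hl : 0 < l.im) :
    HasFDerivAt (coords f) (meanCLM n) (fun _ => l) := by
  have hd : DifferentiableAt ℂ (coords f) (fun _ => l) :=
    hf.holo.differentiableAt ((isOpen_polyPlane n).mem_nhds fun _ => hl)
  have h := hd.hasFDerivAt
  convert h using 1
  refine ContinuousLinearMap.coe_injective (LinearMap.pi_ext' fun j => LinearMap.ext_ring ?_)
  have hup : HasDerivAt (Function.update (fun _ : Fin n => l) j) (Pi.single j 1) l :=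
    hasDerivAt_update _ j l
  have hc : HasDerivAt (fun w => coords f (Function.update (fun _ : Fin n => l) j w))
      (fderiv ℂ (coords f) (fun _ => l) (Pi.single j 1)) l := by
    refine HasFDerivAt.comp_hasDerivAt (l := coords f) l ?_ hup
    rwa [Function.update_eq_self_iff.2 rfl]
  have hp := hf.deriv_diag ⟨l, hl⟩ j
  unfold partialDeriv at hp
  change deriv (fun w => coords f (Function.update (fun _ : Fin n => l) j w)) l = _ at hp
  rw [hc.deriv] at hp
  simp only [LinearMap.comp_apply, LinearMap.single_apply, ContinuousLinearMap.coe_coe, hp,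
    meanCLM_apply]
  simp

/-- Maps of the family `𝒞` agree with the arithmetic mean to second order at high points of the
diagonal, uniformly over the family. -/
theorem IsC.norm_sub_mean_le {n : ℕ} [NeZero n] {f : (Fin n → ℍ) → ℍ} (hf : IsC f) (x : Fin n → ℂ)
    {Y : ℝ} (hY : 2 * ‖x‖ < Y) :
    ‖coords f (fun j => x j + Y * Complex.I) - Y * Complex.I - meanCLM n x‖
      ≤ 60 * ‖x‖ ^ 2 / Y := by
  have hY0 : 0 < Y := lt_of_le_of_lt (by positivity) hY
  set c : Fin n → ℂ := fun _ => Y * Complex.I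
  have hcim : 0 < (Y * Complex.I : ℂ).im := by simpa using hY0
  have hball : ∀ z ∈ Metric.ball c (Y / 2), ∀ j, ‖z j - Y * Complex.I‖ ≤ Y / 2 := by
    intro z hz j
    rw [Metric.mem_ball, dist_eq_norm] at hz
    exact (norm_le_pi_norm (z - c) j).trans hz.le
  have him : ∀ z ∈ Metric.ball c (Y / 2), ∀ j, Y / 2 ≤ (z j).im := by
    intro z hz j
    have h := (Complex.abs_im_le_norm _).trans (hball z hz j)
    simp only [Complex.sub_im, Complex.mul_im, Complex.ofReal_re, Complex.I_im, mul_one,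
      Complex.ofReal_im, Complex.I_re, mul_zero, add_zero] at h
    linarith [(abs_le.1 h).1]
  let χ : (Fin n → ℂ) → ℂ := fun z => coords f z - meanCLM n z
  have hχc : χ c = 0 := by
    simp only [χ, c, hf.coords_diag hcim, meanCLM_const, sub_self]
  have hχd : DifferentiableOn ℂ χ (Metric.ball c (Y / 2)) :=
    (hf.holo.mono fun z hz j => lt_of_lt_of_le (by positivity) (him z hz j)).sub
      (meanCLM n).differentiable.differentiableOn
  -- 15Y = 25Y/2 + 2Y + Y/2: the growth bound with R = 5Y/2 and m = Y/2, the shift by 2iY, and the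
  -- mean of z - c.
  have hχm : Set.MapsTo χ (Metric.ball c (Y / 2)) (Metric.closedBall (χ c) (15 * Y)) := by
    intro z hz
    rw [hχc, mem_closedBall_zero_iff]
    have h2 : ‖(2 * Y * Complex.I : ℂ)‖ = 2 * Y := by simp [abs_of_pos hY0]
    have h1 := hf.norm_coords_add_le (z := z) (R := 5 * Y / 2) hY0 (by positivity)
      (him z hz) (fun j => by
      have h3 : z j + Y * Complex.I = (z j - Y * Complex.I) + 2 * Y * Complex.I := by ring
      rw [h3]
      refine (norm_add_le _ _).trans ?_
      rw [h2]
      linarith [hball z hz j])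
    have h4 : (5 * Y / 2) ^ 2 / (Y / 2) = 25 * Y / 2 := by field_simp; ring
    rw [h4] at h1
    have h5 : ‖meanCLM n (z - c)‖ ≤ Y / 2 :=
      (norm_meanCLM_le _).trans (by rw [← dist_eq_norm]; exact (Metric.mem_ball.1 hz).le)
    have h6 : χ z = (coords f z + Y * Complex.I) - 2 * Y * Complex.I - meanCLM n (z - c) := by
      simp only [χ, map_sub, c, meanCLM_const]
      ring
    rw [h6]
    refine (norm_sub_le _ _).trans ?_
    have := norm_sub_le (coords f z + Y * Complex.I) (2 * Y * Complex.I)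
    rw [h2] at this
    linarith
  have hχo : (fun z => χ z - χ c) =o[𝓝 c] fun w => ‖w - c‖ ^ 1 := by
    have h := (hf.hasFDerivAt hcim).sub (meanCLM n).hasFDerivAt
    have h' := h.isLittleO
    simp only [pow_one]
    refine Asymptotics.IsLittleO.norm_right ?_
    refine h'.congr_left fun z => ?_
    simp [χ, c]
  have hx : (fun j => x j + Y * Complex.I) = c + x := by
    funext j; simp [c, add_comm]
  have hz : c + x ∈ Metric.ball c (Y / 2) := by
    rw [Metric.mem_ball, dist_eq_norm, add_sub_cancel_left]; linarith
  -- Contact o(|w - c|) gains a second power: 15Y (|x| / (Y/2))² = 60 |x|² / Y.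
  have h := Complex.dist_le_mul_div_pow_of_mapsTo_ball_of_isLittleO hχd hχm hχo hz
  rw [hχc, dist_zero_right, dist_eq_norm, add_sub_cancel_left] at h
  have h1 : χ (c + x) = coords f (c + x) - Y * Complex.I - meanCLM n x := by
    simp only [χ, map_add, c, meanCLM_const]; ring
  rw [hx, ← h1]
  refine h.trans (le_of_eq ?_)
  rw [div_pow, div_pow]
  field_simp
  ring

theorem IsC.tendsto_sub_atTop {n : ℕ} [NeZero n] {f : (Fin n → ℍ) → ℍ} (hf : IsC f)
    (x : Fin n → ℂ) :
    Tendsto (fun Y : ℝ => coords f (fun j => x j + Y * Complex.I) - Y * Complex.I) atTop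
      (𝓝 (meanCLM n x)) := by
  rw [tendsto_iff_norm_sub_tendsto_zero]
  refine squeeze_zero' (Eventually.of_forall fun _ => norm_nonneg _) ?_
    ((tendsto_const_nhds (x := 60 * ‖x‖ ^ 2)).div_atTop tendsto_id)
  filter_upwards [eventually_gt_atTop (2 * ‖x‖)] with Y hY using hf.norm_sub_mean_le x hY

/-! ### Slices parallel to the diagonal and their averages -/

theorem continuous_coords_eval {n : ℕ} (z : Fin n → ℂ) :
    Continuous fun f : FamC n => coords f.1 z := by
  have h : Continuous fun f : FamC n => f.1 (fun j => ofComplex (z j)) :=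
    (continuous_eval_const _).comp continuous_subtype_val
  exact continuous_coe.comp h

/-- The restriction of `f` to the complex line through `x` parallel to the diagonal, minus the
identity. -/
def diagSub {n : ℕ} (x : Fin n → ℝ) (f : (Fin n → ℍ) → ℍ) (s : ℂ) : ℂ :=
  coords f (fun j => x j + s) - s

theorem IsC.differentiableOn_diagSub {n : ℕ} {f : (Fin n → ℍ) → ℍ} (hf : IsC f) (x : Fin n → ℝ) :
    DifferentiableOn ℂ (diagSub x f) {s | 0 < s.im} := by
  have h1 : DifferentiableOn ℂ (fun (s : ℂ) (j : Fin n) => (x j : ℂ) + s) {s | 0 < s.im} := by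
    fun_prop
  have h2 := hf.holo.comp h1 fun s hs j => by simpa using hs
  exact h2.sub differentiableOn_id

theorem isOpen_im_pos : IsOpen {s : ℂ | 0 < s.im} :=
  isOpen_lt continuous_const Complex.continuous_im

theorem isPreconnected_im_pos : IsPreconnected {s : ℂ | 0 < s.im} :=
  (convex_halfSpace_im_gt 0).isPreconnected

/-- A bound uniform over the family; it provides integrability, and the domination needed to
differentiate under the integral. -/
theorem IsC.norm_diagSub_le {n : ℕ} [NeZero n] {f : (Fin n → ℍ) → ℍ} (hf : IsC f)
    (x : Fin n → ℝ) {s : ℂ} {m R : ℝ} (hm : 0 < m) (hs : m ≤ s.im) (hR : ‖s‖ ≤ R) :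
    ‖diagSub x f s‖ ≤ (‖x‖ + R + 1) ^ 2 / m + 1 + R := by
  have h := hf.norm_coords_add_le (z := fun j => x j + s) (Y := 1) (R := ‖x‖ + R + 1) one_pos hm
    (fun j => by simpa using hs) (fun j => by
      have h1 : ‖(x j : ℂ)‖ ≤ ‖x‖ := by simpa using norm_le_pi_norm x j
      have h2 := norm_add₃_le (a := (x j : ℂ)) (b := s) (c := (1 : ℝ) * Complex.I)
      have h3 : ‖((1 : ℝ) * Complex.I : ℂ)‖ = 1 := by simp
      linarith)
  have h4 : diagSub x f s
      = (coords f (fun j => x j + s) + (1 : ℝ) * Complex.I) - Complex.I - s := by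
    simp [diagSub]
  rw [h4]
  refine (norm_sub_le _ _).trans (add_le_add ((norm_sub_le _ _).trans (add_le_add h ?_)) hR)
  simp

theorem measurable_diagSub {n : ℕ} (x : Fin n → ℝ) (s : ℂ) :
    Measurable fun f : FamC n => diagSub x f.1 s :=
  ((continuous_coords_eval _).sub continuous_const).measurable

theorem integrable_diagSub {n : ℕ} [NeZero n] (μ : Measure (FamC n)) [IsFiniteMeasure μ]
    (x : Fin n → ℝ) {s : ℂ} (hs : 0 < s.im) :
    Integrable (fun f : FamC n => diagSub x f.1 s) μ :=
  Integrable.of_bound (measurable_diagSub x s).aestronglyMeasurable _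
    (Eventually.of_forall fun f => f.2.norm_diagSub_le x hs le_rfl le_rfl)

theorem measurable_deriv_diagSub {n : ℕ} (x : Fin n → ℝ) {s : ℂ} (hs : 0 < s.im) :
    Measurable fun f : FamC n => deriv (diagSub x f.1) s := by
  refine measurable_of_tendsto_metrizable' (𝓝[≠] s)
    (f := fun w (f : FamC n) => slope (diagSub x f.1) s w) (fun w => ?_) ?_
  · simp only [slope_def_field]
    exact ((measurable_diagSub x w).sub (measurable_diagSub x s)).div_const _
  · refine tendsto_pi_nhds.2 fun f => ?_
    exact ((f.2.differentiableOn_diagSub x).differentiableAt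
      (isOpen_im_pos.mem_nhds hs)).hasDerivAt.tendsto_slope

theorem differentiableAt_integral_diagSub {n : ℕ} [NeZero n] (μ : Measure (FamC n))
    [IsFiniteMeasure μ] (x : Fin n → ℝ) {s : ℂ} (hs : 0 < s.im) :
    DifferentiableAt ℂ (fun w => ∫ f : FamC n, diagSub x f.1 w ∂μ) s := by
  -- Discs of radius Im s / 4 about points of the ball of that radius stay at height at least Im s /
  -- 2, so Cauchy's estimate bounds the derivatives uniformly in `f`.
  have hr : 0 < s.im / 4 := by positivity
  have him : ∀ w ∈ Metric.ball s (s.im / 4), ∀ v ∈ Metric.closedBall w (s.im / 4),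
      s.im / 2 ≤ v.im ∧ ‖v‖ ≤ ‖s‖ + s.im / 2 := by
    intro w hw v hv
    have h1 : ‖v - s‖ ≤ s.im / 2 := by
      have := dist_triangle v w s
      rw [← dist_eq_norm]
      linarith [Metric.mem_ball.1 hw, Metric.mem_closedBall.1 hv]
    have h2 := (abs_le.1 ((Complex.abs_im_le_norm _).trans h1)).1
    have h3 := norm_add_le (v - s) s
    rw [sub_add_cancel] at h3
    rw [Complex.sub_im] at h2
    exact ⟨by linarith, by linarith⟩
  have hpos : ∀ w ∈ Metric.ball s (s.im / 4), 0 < w.im := fun w hw => by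
    have := (him w hw w (Metric.mem_closedBall_self hr.le)).1
    linarith
  refine (hasDerivAt_integral_of_dominated_loc_of_deriv_le
    (F' := fun w (f : FamC n) => deriv (diagSub x f.1) w)
    (bound := fun _ => ((‖x‖ + (‖s‖ + s.im / 2) + 1) ^ 2 / (s.im / 2) + 1 + (‖s‖ + s.im / 2))
      / (s.im / 4))
    (Metric.ball_mem_nhds s hr)
    (Eventually.of_forall fun w => (measurable_diagSub x w).aestronglyMeasurable)
    (integrable_diagSub μ x hs) (measurable_deriv_diagSub x hs).aestronglyMeasurable
    (Eventually.of_forall fun f w hw => ?_) (integrable_const _)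
    (Eventually.of_forall fun f w hw => ?_)).2.differentiableAt
  · refine Complex.norm_deriv_le_of_forall_mem_sphere_norm_le hr ?_ fun v hv => ?_
    · refine DifferentiableOn.diffContOnCl ((f.2.differentiableOn_diagSub x).mono fun v hv => ?_)
      have := (him w hw v (Metric.closure_ball_subset_closedBall hv)).1
      exact lt_of_lt_of_le (by positivity) this
    · have := him w hw v (Metric.sphere_subset_closedBall hv)
      exact f.2.norm_diagSub_le x (by positivity) this.1 this.2
  · exact ((f.2.differentiableOn_diagSub x).differentiableAt
      (isOpen_im_pos.mem_nhds (hpos w hw))).hasDerivAt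

/-! ### Invariant measures: the barycentre is the mean -/

theorem diagSub_translate {n : ℕ} (x : Fin n → ℝ) (f : C(Fin n → ℍ, ℍ)) {s : ℂ} (hs : 0 < s.im)
    (t : ℝ) : diagSub x (translate t f) s = diagSub x f (s - t) := by
  rw [diagSub, coords_translate t f fun j => by simpa using hs, diagSub]
  simp only [add_sub_assoc]
  ring

theorem integral_diagSub_add_real {n : ℕ} {μ : Measure (FamC n)}
    (hμ : IsInvariantMeasure (translationFlow n) μ) (x : Fin n → ℝ) {s : ℂ} (hs : 0 < s.im)
    (t : ℝ) : ∫ f : FamC n, diagSub x f.1 (s + t) ∂μ = ∫ f : FamC n, diagSub x f.1 s ∂μ := by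
  have h := hμ (-t)
  conv_rhs => rw [← h.map_eq]
  rw [integral_map h.measurable.aemeasurable (measurable_diagSub x s).aestronglyMeasurable]
  refine integral_congr_ae (Eventually.of_forall fun f => ?_)
  change _ = diagSub x (translate (-t) f.1) s
  rw [diagSub_translate x f.1 hs]
  simp

theorem IsC.tendsto_diagSub_atTop {n : ℕ} [NeZero n] {f : (Fin n → ℍ) → ℍ} (hf : IsC f)
    (x : Fin n → ℝ) :
    Tendsto (fun Y : ℝ => diagSub x f (Y * Complex.I)) atTop (𝓝 (meanCLM n fun j => x j)) :=
  hf.tendsto_sub_atTop fun j => (x j : ℂ)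

/-- The barycentre of an invariant probability measure takes the same values as the mean. -/
theorem integral_diagSub_eq {n : ℕ} [NeZero n] {μ : Measure (FamC n)} [IsProbabilityMeasure μ]
    (hμ : IsInvariantMeasure (translationFlow n) μ) (x : Fin n → ℝ) {s : ℂ} (hs : 0 < s.im) :
    ∫ f : FamC n, diagSub x f.1 s ∂μ = meanCLM n fun j => x j := by
  set H : ℂ → ℂ := fun w => ∫ f : FamC n, diagSub x f.1 w ∂μ
  have hd : ∀ w : ℂ, 0 < w.im → DifferentiableAt ℂ H w := fun w hw =>
    differentiableAt_integral_diagSub μ x hw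
  have hderiv : Set.EqOn (deriv H) 0 {w | 0 < w.im} := by
    intro w hw
    -- The complex derivative can be computed in the real direction, along which `H` is constant.
    have h1 : HasDerivAt (fun t : ℝ => H (w + t)) (deriv H w) 0 := by
      have h2 : HasDerivAt (fun v : ℂ => H (w + v)) (deriv H w) ((0 : ℝ) : ℂ) := by
        refine HasDerivAt.comp_const_add w _ ?_
        simpa using (hd w hw).hasDerivAt
      exact h2.comp_ofReal
    have h3 : (fun t : ℝ => H (w + t)) = fun _ => H w :=
      funext fun t => integral_diagSub_add_real hμ x hw t
    rw [h3] at h1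
    exact h1.unique (hasDerivAt_const _ _)
  have hconst : ∀ w : ℂ, 0 < w.im → H w = H s := fun w hw =>
    isOpen_im_pos.is_const_of_deriv_eq_zero isPreconnected_im_pos
      (fun v hv => (hd v hv).differentiableWithinAt) hderiv hw hs
  have hlim : Tendsto (fun Y : ℝ => H (Y * Complex.I)) atTop (𝓝 (meanCLM n fun j => x j)) := by
    have h4 : ∫ _ : FamC n, (meanCLM n fun j => (x j : ℂ)) ∂μ = meanCLM n fun j => (x j : ℂ) := by
      simp
    rw [← h4]
    refine tendsto_integral_filter_of_dominated_convergence
      (fun _ => ‖meanCLM n fun j => (x j : ℂ)‖ + 60 * ‖fun j => (x j : ℂ)‖ ^ 2)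
      (Eventually.of_forall fun Y => (measurable_diagSub x _).aestronglyMeasurable) ?_
      (integrable_const _) (Eventually.of_forall fun f => f.2.tendsto_diagSub_atTop x)
    filter_upwards [eventually_gt_atTop (2 * ‖fun j => (x j : ℂ)‖), eventually_ge_atTop 1]
      with Y hY hY1
    refine Eventually.of_forall fun f => ?_
    have h5 := f.2.norm_sub_mean_le (fun j => (x j : ℂ)) hY
    have h6 : 60 * ‖fun j => (x j : ℂ)‖ ^ 2 / Y ≤ 60 * ‖fun j => (x j : ℂ)‖ ^ 2 :=
      div_le_self (by positivity) hY1
    have h7 := norm_le_norm_add_norm_sub' (diagSub x f.1 (Y * Complex.I))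
      (meanCLM n fun j => (x j : ℂ))
    exact h7.trans (add_le_add_right (h5.trans h6) _)
  refine tendsto_nhds_unique (Tendsto.congr' ?_ tendsto_const_nhds) hlim
  filter_upwards [eventually_gt_atTop 0] with Y hY
  exact (hconst _ (by simpa using hY)).symm

/-! ### Rigidity: from vanishing imaginary part to the mean -/

theorem IsC.diagSub_eq_of_im_eq_zero {n : ℕ} [NeZero n] {f : (Fin n → ℍ) → ℍ} (hf : IsC f)
    (x : Fin n → ℝ) {s : ℂ} (hs : 0 < s.im) (h0 : (diagSub x f s).im = 0) :
    diagSub x f s = meanCLM n fun j => x j := by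
  have hnn : ∀ w : ℂ, 0 < w.im → 0 ≤ (diagSub x f w).im := fun w hw => by
    simpa [diagSub] using hf.im_le x hw
  have han : AnalyticOnNhd ℂ (diagSub x f) {w | 0 < w.im} :=
    (hf.differentiableOn_diagSub x).analyticOnNhd isOpen_im_pos
  rcases han.is_constant_or_isOpen isPreconnected_im_pos with ⟨c, hc⟩ | hopen
  · rw [hc s hs]
    refine tendsto_nhds_unique (Tendsto.congr' ?_ tendsto_const_nhds) (hf.tendsto_diagSub_atTop x)
    filter_upwards [eventually_gt_atTop 0] with Y hY
    exact (hc _ (by simpa using hY)).symm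
  · exfalso
    have ho := hopen _ subset_rfl isOpen_im_pos
    obtain ⟨ε, hε, hb⟩ := Metric.isOpen_iff.1 ho _ ⟨s, hs, rfl⟩
    -- An open image would contain a point just below the real value, contradicting `hnn`.
    obtain ⟨w, hw, hw'⟩ : diagSub x f s - (ε / 2 : ℝ) * Complex.I ∈ diagSub x f '' {w | 0 < w.im} :=
      hb (by
        rw [Metric.mem_ball, dist_eq_norm, sub_sub_cancel_left, norm_neg, norm_mul,
          Complex.norm_real, Complex.norm_I, Real.norm_of_nonneg (by positivity)]
        linarith)
    have h1 := hnn w hw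
    rw [hw'] at h1
    simp [h0] at h1
    linarith

/-- A map of the family `𝒞` that agrees with the mean on `ℝⁿ + i` is the mean. -/
theorem eq_meanC_of_diagSub {n : ℕ} [NeZero n] {f : FamC n}
    (h : ∀ x : Fin n → ℝ, diagSub x f.1 Complex.I = meanCLM n fun j => x j) : f = meanC n := by
  refine Subtype.ext (ContinuousMap.ext fun z => UpperHalfPlane.ext ?_)
  change (f.1 z : ℂ) = (1 / (n : ℂ)) * ∑ j, (z j : ℂ)
  -- A complex line that lies in ℝⁿ + i for real ζ and passes through `z` at ζ = i. The part `U` of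
  -- it inside the poly-plane is convex and contains 0 and i, so the identity theorem carries the
  -- equality from real ζ to `z`.
  let p : ℂ → Fin n → ℂ := fun ζ j => (z j).re + Complex.I + ζ * ((z j).im - 1)
  let U : Set ℂ := ⋂ j, {ζ : ℂ | 0 < 1 + ζ.im * ((z j).im - 1)}
  have hU : IsOpen U := isOpen_iInter_of_finite fun j =>
    isOpen_lt continuous_const (by fun_prop)
  have hUc : Convex ℝ U := by
    refine convex_iInter fun j => ?_
    intro a ha b hb u v hu hv huv
    simp only [Set.mem_ofPred_eq, Complex.add_im, Complex.real_smul, Complex.mul_im,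
      Complex.ofReal_re, Complex.ofReal_im, zero_mul, add_zero] at ha hb ⊢
    have h1 : 1 + (u * a.im + v * b.im) * ((z j).im - 1)
        = u * (1 + a.im * ((z j).im - 1)) + v * (1 + b.im * ((z j).im - 1)) := by
      linear_combination -huv
    rw [h1]
    rcases hu.eq_or_lt with rfl | hu'
    · have : v = 1 := by linarith
      subst this
      linarith
    · exact add_pos_of_pos_of_nonneg (mul_pos hu' ha) (mul_nonneg hv hb.le)
  have hp : ∀ ζ ∈ U, p ζ ∈ polyPlane n := by
    intro ζ hζ j
    have := Set.mem_iInter.1 hζ j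
    simpa [p] using this
  have hpd : Differentiable ℂ p := by
    refine differentiable_pi.2 fun j => ?_
    simp only [p]
    fun_prop
  have hF : AnalyticOnNhd ℂ (fun ζ => coords f.1 (p ζ)) U :=
    (f.2.holo.comp hpd.differentiableOn hp).analyticOnNhd hU
  have hG : AnalyticOnNhd ℂ (fun ζ => meanCLM n (p ζ)) U :=
    ((meanCLM n).differentiable.comp hpd).differentiableOn.analyticOnNhd hU
  have hreal : ∀ t : ℝ, coords f.1 (p t) = meanCLM n (p t) := by
    intro t
    have h1 := h fun j => (z j).re + t * ((z j).im - 1)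
    have h2 : p t = fun j =>
        (((z j).re + t * ((z j).im - 1) : ℝ) : ℂ) + Complex.I := by
      funext j
      simp only [p]
      push_cast
      ring
    have h3 : p t = (fun j => (((z j).re + t * ((z j).im - 1) : ℝ) : ℂ)) + fun _ => Complex.I := h2
    rw [diagSub, sub_eq_iff_eq_add] at h1
    rw [h2, h1, ← h2, h3, map_add, meanCLM_const]
  have h0 : (0 : ℂ) ∈ U := Set.mem_iInter.2 fun j => by simp
  have hI : Complex.I ∈ U := Set.mem_iInter.2 fun j => by simpa using (z j).im_pos
  have hfreq : ∃ᶠ ζ in 𝓝[≠] (0 : ℂ), coords f.1 (p ζ) = meanCLM n (p ζ) := by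
    have ht : Tendsto (fun t : ℝ => (t : ℂ)) (𝓝[≠] 0) (𝓝[≠] 0) := by
      refine tendsto_nhdsWithin_iff.2 ⟨?_, ?_⟩
      · exact (Complex.continuous_ofReal.tendsto' 0 0 (by simp)).mono_left nhdsWithin_le_nhds
      · filter_upwards [self_mem_nhdsWithin] with t ht
        simpa using ht
    exact ht.frequently (Eventually.of_forall fun t => hreal t).frequently
  have hend := hF.eqOn_of_preconnected_of_frequently_eq hG hUc.isPreconnected h0 hfreq hI
  have hpI : p Complex.I = fun j => (z j : ℂ) := by
    funext j
    simp only [p]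
    apply Complex.ext <;> simp
  simp only [hpI] at hend
  rw [meanCLM_apply, coords_of_mem f.1 fun j => (z j).im_pos] at hend
  exact hend

theorem ae_eq_meanC {n : ℕ} [NeZero n] {μ : Measure (FamC n)} [IsProbabilityMeasure μ]
    (hμ : IsInvariantMeasure (translationFlow n) μ) : ∀ᵐ f ∂μ, f = meanC n := by
  have hI : 0 < Complex.I.im := by simp
  have hx : ∀ x : Fin n → ℝ, ∀ᵐ f : FamC n ∂μ, diagSub x f.1 Complex.I = meanCLM n fun j => x j := by
    intro x
    have hint := integrable_diagSub μ x hI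
    have h1 : ∫ f : FamC n, (diagSub x f.1 Complex.I).im ∂μ = 0 := by
      have h2 : ∫ f : FamC n, (diagSub x f.1 Complex.I).im ∂μ
          = (∫ f : FamC n, diagSub x f.1 Complex.I ∂μ).im := integral_im hint
      rw [h2, integral_diagSub_eq hμ x hI, meanCLM_apply]
      have h3 : (1 / (n : ℂ)) * ∑ j, (x j : ℂ) = ((1 / n * ∑ j, x j : ℝ) : ℂ) := by push_cast; rfl
      rw [h3, Complex.ofReal_im]
    have hnn : ∀ f : FamC n, 0 ≤ (diagSub x f.1 Complex.I).im := fun f => by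
      have := f.2.im_le x hI
      simpa [diagSub] using this
    have h4 := (integral_eq_zero_iff_of_nonneg hnn hint.im).1 h1
    filter_upwards [h4] with f hf
    exact f.2.diagSub_eq_of_im_eq_zero x hI hf
  -- The null set depends on `x`: a countable dense set is treated first, and continuity in `x`
  -- gives the rest.
  have hall := ae_all_iff.2 fun k : ℕ => hx (TopologicalSpace.denseSeq (Fin n → ℝ) k)
  filter_upwards [hall] with f hf
  refine eq_meanC_of_diagSub fun x => ?_
  have hc1 : Continuous fun x : Fin n → ℝ => diagSub x f.1 Complex.I := by
    have h5 : Continuous fun (x : Fin n → ℝ) (j : Fin n) => (x j : ℂ) + Complex.I := by fun_prop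
    exact (f.2.holo.continuousOn.comp_continuous h5 fun x j => by simp).sub continuous_const
  have hc2 : Continuous fun x : Fin n → ℝ => meanCLM n fun j => (x j : ℂ) :=
    (meanCLM n).continuous.comp (by fun_prop)
  exact congrFun (hc1.ext_on (TopologicalSpace.denseRange_denseSeq _) hc2
    (by rintro _ ⟨k, rfl⟩; exact hf k)) x

/-! ### The Dirac measure at the mean and the conclusion -/

theorem translationFlow_meanC {n : ℕ} [NeZero n] (t : ℝ) :
    translationFlow n t (meanC n) = meanC n := by
  have hn : (n : ℂ) ≠ 0 := by exact_mod_cast NeZero.ne n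
  refine Subtype.ext (ContinuousMap.ext fun z => UpperHalfPlane.ext ?_)
  change ((t +ᵥ meanPoint (fun j => (-t) +ᵥ z j) : ℍ) : ℂ) = meanPoint z
  rw [coe_vadd]
  change (t : ℂ) + (1 / (n : ℂ)) * ∑ j, (((-t) +ᵥ z j : ℍ) : ℂ) = (1 / (n : ℂ)) * ∑ j, (z j : ℂ)
  simp only [coe_vadd, Finset.sum_add_distrib, Finset.sum_const, Finset.card_univ,
    Fintype.card_fin, nsmul_eq_mul]
  push_cast
  field_simp
  ring

theorem isInvariantMeasure_dirac_meanC (n : ℕ) [NeZero n] :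
    IsInvariantMeasure (translationFlow n) (Measure.dirac (meanC n)) := by
  intro t
  have hm : Measurable (translationFlow n t) :=
    ((translationFlow n).continuous continuous_const continuous_id).measurable
  refine ⟨hm, ?_⟩
  rw [Measure.map_dirac' hm, translationFlow_meanC]

theorem isInvariantMeasure_iff_eq_dirac {n : ℕ} [NeZero n] (μ : Measure (FamC n)) :
    (IsProbabilityMeasure μ ∧ IsInvariantMeasure (translationFlow n) μ)
      ↔ μ = Measure.dirac (meanC n) := by
  constructor
  · rintro ⟨hp, hμ⟩
    -- Almost everywhere equal maps have equal push-forwards: `μ` itself under the identity, the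
    -- Dirac measure under the constant map.
    have h : (id : FamC n → FamC n) =ᵐ[μ] fun _ => meanC n := ae_eq_meanC hμ
    have h1 : μ.map (id : FamC n → FamC n) = μ.map fun _ => meanC n := Measure.map_congr h
    rwa [Measure.map_id, Measure.map_const, measure_univ, one_smul] at h1
  · rintro rfl
    exact ⟨inferInstance, isInvariantMeasure_dirac_meanC n⟩

end PolyPlane

end

theorem proposition4p2 (n : ℕ) [NeZero n] :
    (∀ μ : MeasureTheory.Measure (PolyPlane.FamC n),
      (MeasureTheory.IsProbabilityMeasure μ ∧
          PolyPlane.IsInvariantMeasure (PolyPlane.translationFlow n) μ) ↔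
        μ = MeasureTheory.Measure.dirac (PolyPlane.meanC n)) ∧
      PolyPlane.IsUniquelyErgodic (PolyPlane.translationFlow n) := by
  refine ⟨PolyPlane.isInvariantMeasure_iff_eq_dirac, MeasureTheory.Measure.dirac (PolyPlane.meanC n),
    (PolyPlane.isInvariantMeasure_iff_eq_dirac _).2 rfl,
    fun μ hμ => (PolyPlane.isInvariantMeasure_iff_eq_dirac μ).1 hμ⟩
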